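/- **Conventions.** A *median set* is a set $X$ with a ternary operation $m$ satisfying $m(x,y,z)=m(y,x,z)=m(x,z,y)$, $m(x,y,x)=x$ and $m(m(x,y,z),s,t)=m(m(x,s,t),m(y,s,t),z)$. A subset $A\subseteq X$ is *convex* if $m(x,y,z)\in A$ whenever $x,y\in A$, $z\in X$; it is *prime* if both $A$ and $X\setminus A$ are convex ($\emptyset$ and $X$ are allowed). A group $G$ acts on a median set $X$ if it acts on the set $X$ and $g\,m(x,y,z)=m(gx,gy,gz)$. A morphism $(G,X)\to(G',X')$ of actions on median sets is a pair $(\psi_0,\psi)$ of a group morphism $\psi_0:G\to G'$ and a map $\psi:X\to X'$ preserving medians with $\psi(gx)=\psi_0(g)\psi(x)$; it is an embedding if $\psi_0$ and $\psi$ are injective. **Construction.** Let $H$ be a group acting freely on a nonempty median set $(X,m)$. Let $B\subseteq X$ be a set of representatives of the $H$-orbits, $b_1\in B$ a base point, $F$ the free group with base $B\setminus\{b_1\}$, and $\hat H=H*F$. Let $\iota:X\to\hat H$ be the map with $\iota(hb_1)=h$ and $\iota(hb)=hb$ for $h\in H$, $b\in B\setminus\{b_1\}$. Let $$\mathfrak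 S=\{P\subseteq\hat H : \{x\in X: g\,\iota(x)\in P\}\text{ is a prime convex subset of }X\text{ for all }g\in\hat H\},$$ on which $\hat H$ acts by $gP=\{gv: v\in P\}$. For $\mathfrak M\subseteq\mathfrak S$ let $g\mathfrak M=\{gP: P\in\mathfrak M\}$ and $\neg\mathfrak M=\{P\in\mathfrak S:\hat H\setminus P\notin\mathfrak M\}$. Let $\mathfrak U(g)=\{P\in\mathfrak S: g\notin P\}$ for $g\in\hat H$, let $\mathfrak L$ be the lattice of subsets of $\mathfrak S$ generated by the sets $\mathfrak U(g)$, $g\in\hat H$, under binary unions and intersections, and let $\hat X=\{\mathfrak M\in\mathfrak L:\neg\mathfrak M=\mathfrak M\}$, with the median operation $(\mathfrak A,\mathfrak B,\mathfrak C)\mapsto(\mathfrak A\cap\mathfrak B)\cup(\mathfrak B\cap\mathfrak C)\cup(\mathfrak C\cap\mathfrak A)$ and the base point $\mathfrak U(1)$. **Theorem.** For every such choice of $B$ and $b_1$ the following hold. 1. $\mathfrak L$ is closed under $\neg$, the set $\hat X$ is a median set, and $\hat H$ acts freely on this median set by $\mathfrak M\mapsto g\mathfrak M$. 2. The inclusion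 $H\to\hat H$ together with the map $X\to\hat X$, $x\mapsto\iota(x)\,\mathfrak U(1)$, is an embedding $j:(H,X)\to(\hat H,\hat X)$ of actions on median sets, and the image of $X$ lies in one $\hat H$-orbit. 3. (RTUP) For every free action of a group $\tilde H$ on a median set $\tilde X$ and every morphism $\psi=(\psi_0,\psi):(H,X)\to(\tilde H,\tilde X)$ with $\psi(X)\subseteq\tilde H\psi(x)$ for some $x\in X$, there is a unique morphism $\hat\psi:(\hat H,\hat X)\to(\tilde H,\tilde X)$ with $\hat\psi\circ j=\psi$. 4. In particular the extension is unique up to a unique isomorphism: if $j':(H,X)\to(H',X')$ is an embedding into a free action on a median set such that $j'(X)$ lies in one $H'$-orbit and $j'$ also satisfies (RTUP), then there is a unique isomorphism $\Phi:(\hat H,\hat X)\to(H',X')$ with $\Phi\circ j=j'$. -/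

import Mathlib

universe u v u' v' u'' v'' w₁ w₂

/-! ## Median sets -/

/-- A median set (median algebra): a set with a symmetric, absorptive and selfdistributive ternary
operation `med`. -/
class MedianSet (X : Type v) where
  med : X → X → X → X
  med_swap_left : ∀ x y z, med x y z = med y x z
  med_swap_right : ∀ x y z, med x y z = med x z y
  med_absorb : ∀ x y, med x y x = x
  med_distrib : ∀ x y z s t, med (med x y z) s t = med (med x s t) (med y s t) z

namespace MedianSet

variable {X : Type v} [MedianSet X]

/-- A subset containing `med x y z` as soon as it contains `x` and `y`. -/
def IsConvex (A : Set X) : Prop :=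
  ∀ x y z : X, x ∈ A → y ∈ A → med x y z ∈ A

/-- Prime convex subsets: convex subsets with convex complement (`∅` and the whole set are
allowed). -/
def IsPrimeConvex (A : Set X) : Prop :=
  IsConvex A ∧ IsConvex Aᶜ

theorem IsPrimeConvex.compl {A : Set X} (h : IsPrimeConvex A) : IsPrimeConvex Aᶜ :=
  ⟨h.2, (compl_compl A).symm ▸ h.1⟩

end MedianSet

/-! ## Actions on median sets and their morphisms -/

/-- The group `G` acts on the median set `X` by automorphisms of median sets. -/
class IsMedianAction (G : Type u) (X : Type v) [Group G] [MedianSet X] [MulAction G X] :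
    Prop where
  smul_med : ∀ (g : G) (x y z : X),
    g • MedianSet.med x y z = MedianSet.med (g • x) (g • y) (g • z)

/-- A morphism of actions on median sets: a group morphism together with a compatible morphism of
median sets. -/
@[ext]
structure ActHom (G : Type u) (X : Type v) (G' : Type u') (X' : Type v')
    [Group G] [MedianSet X] [MulAction G X] [Group G'] [MedianSet X'] [MulAction G' X'] where
  groupHom : G →* G'
  map : X → X'
  map_med : ∀ x y z : X,
    map (MedianSet.med x y z) = MedianSet.med (map x) (map y) (map z)
  map_smul : ∀ (g : G) (x : X), map (g • x) = groupHom g • map x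

namespace ActHom

variable {G : Type u} {X : Type v} {G' : Type u'} {X' : Type v'} {G'' : Type u''} {X'' : Type v''}
  [Group G] [MedianSet X] [MulAction G X] [Group G'] [MedianSet X'] [MulAction G' X']
  [Group G''] [MedianSet X''] [MulAction G'' X'']

/-- The identity morphism. -/
def id (G : Type u) (X : Type v) [Group G] [MedianSet X] [MulAction G X] : ActHom G X G X where
  groupHom := MonoidHom.id G
  map := fun x => x
  map_med := fun _ _ _ => rfl
  map_smul := fun _ _ => rfl

/-- Composition of morphisms, `g` after `f`. -/
def comp (g : ActHom G' X' G'' X'') (f : ActHom G X G' X') : ActHom G X G'' X'' where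
  groupHom := g.groupHom.comp f.groupHom
  map := fun x => g.map (f.map x)
  map_med := fun x y z => by rw [f.map_med, g.map_med]
  map_smul := fun a x => by rw [f.map_smul, g.map_smul]; rfl

/-- Isomorphisms of actions on median sets. -/
def IsIso (f : ActHom G X G' X') : Prop :=
  ∃ g : ActHom G' X' G X, g.comp f = ActHom.id G X ∧ f.comp g = ActHom.id G' X'

/-- Embeddings: injective on the group and on the median set. -/
def IsEmbedding (f : ActHom G X G' X') : Prop :=
  Function.Injective f.groupHom ∧ Function.Injective f.map

/-- The image of the median set lies in the orbit of the image of one of its points. -/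
def ImageInOneOrbit (f : ActHom G X G' X') : Prop :=
  ∃ x : X, ∀ y : X, f.map y ∈ MulAction.orbit G' (f.map x)

/-- The universal property of the relatively-transitive closure, tested on free actions of groups
in `Type w₁` on median sets in `Type w₂`: every morphism `ψ` from the source of `j` into a free
action, with image in one orbit, factors uniquely through `j`. -/
def RTUP (j : ActHom G X G' X') : Prop :=
  ∀ (K : Type w₁) (Y : Type w₂) [Group K] [MedianSet Y] [MulAction K Y]
    [IsMedianAction K Y] [IsCancelSMul K Y] (ψ : ActHom G X K Y),
    ψ.ImageInOneOrbit → ∃! Ψ : ActHom G' X' K Y, Ψ.comp j = ψ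

end ActHom

/-! ## Representatives of the orbits and the free product -/

/-- A set of representatives for the orbits of `H` in `X`, one of them chosen as base point. -/
structure OrbitReps (H : Type u) (X : Type v) [Group H] [MulAction H X] where
  reps : Set X
  base : X
  base_mem : base ∈ reps
  existsUnique : ∀ x : X, ∃! b : X, b ∈ reps ∧ x ∈ MulAction.orbit H b

namespace OrbitReps

/-- Every point of `X` is the base point of some system of representatives. -/
theorem exists_base {H : Type u} {X : Type v} [Group H] [MulAction H X] (b₁ : X) :
    ∃ D : OrbitReps H X, D.base = b₁ := by
  classical
  let f : MulAction.orbitRel.Quotient H X → X :=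
    fun q => if q = Quotient.mk'' b₁ then b₁ else q.out
  have hf : ∀ q, (Quotient.mk'' (f q) : MulAction.orbitRel.Quotient H X) = q := by
    intro q
    by_cases h : q = Quotient.mk'' b₁
    · simp only [f, if_pos h]
      exact h.symm
    · simp only [f, if_neg h]
      exact Quotient.out_eq' q
  have horb : ∀ x y : X, x ∈ MulAction.orbit H y ↔
      (Quotient.mk'' x : MulAction.orbitRel.Quotient H X) = Quotient.mk'' y := by
    intro x y
    rw [Quotient.eq'']
    rfl
  refine ⟨⟨Set.range f, b₁, ⟨Quotient.mk'' b₁, if_pos rfl⟩, fun x => ?_⟩, rfl⟩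
  refine ⟨f (Quotient.mk'' x), ⟨⟨_, rfl⟩, (horb _ _).2 (hf _).symm⟩, ?_⟩
  rintro _ ⟨⟨q, rfl⟩, h⟩
  rw [horb, hf] at h
  rw [h]

variable {H : Type u} {X : Type v} [Group H] [MulAction H X] (D : OrbitReps H X)

/-- The base of the free group `F`: the representatives other than the base point. -/
abbrev FreeBase : Type v := {b : X // b ∈ D.reps ∧ b ≠ D.base}

/-- The group `Ĥ = H * F`, the free product of `H` and the free group `F`. -/
abbrev Hat : Type (max u v) := Monoid.Coprod H (FreeGroup D.FreeBase)

/-- The element of `Ĥ` attached to a point of `X` thought of as a representative: `1` for the base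
point, and the corresponding generator of `F` for any other representative. -/
noncomputable def gen (b : X) : D.Hat :=
  open scoped Classical in
  if h : b ∈ D.reps ∧ b ≠ D.base then Monoid.Coprod.inr (FreeGroup.of ⟨b, h⟩) else 1

/-- The representative of the orbit of `x`. -/
noncomputable def rep (x : X) : X := (D.existsUnique x).choose

theorem rep_spec (x : X) : D.rep x ∈ D.reps ∧ x ∈ MulAction.orbit H (D.rep x) :=
  (D.existsUnique x).choose_spec.1

/-- An element `h` of `H` (unique if the action is free) with `x = h • rep x`. -/
noncomputable def coef (x : X) : H := (D.rep_spec x).2.choose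

theorem coef_smul_rep (x : X) : D.coef x • D.rep x = x := (D.rep_spec x).2.choose_spec

/-- The map `X → Ĥ`, `h • b ↦ h b` for `h` in `H` and `b` a representative. -/
noncomputable def emb (x : X) : D.Hat := Monoid.Coprod.inl (D.coef x) * D.gen (D.rep x)

/-- For a free action, `emb` is given on `X` by the formula `h • b ↦ h b`. -/
theorem emb_smul_of_mem [IsCancelSMul H X] (h : H) {b : X} (hb : b ∈ D.reps) :
    D.emb (h • b) = Monoid.Coprod.inl h * D.gen b := by
  have hr : D.rep (h • b) = b :=
    (D.existsUnique (h • b)).unique (D.rep_spec _) ⟨hb, h, rfl⟩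
  have hc : D.coef (h • b) = h := by
    have h1 := D.coef_smul_rep (h • b)
    rw [hr] at h1
    exact IsCancelSMul.right_cancel _ _ _ h1
  rw [emb, hr, hc]

end OrbitReps

/-! ## The median set on which `Ĥ` acts -/

namespace OrbitReps

variable {H : Type u} {X : Type v} [Group H] [MedianSet X] [MulAction H X] (D : OrbitReps H X)

/-- The family `𝔖` of "prime" subsets of `Ĥ`: those `P ⊆ Ĥ` such that, for every `g` in `Ĥ`, the
trace of `g⁻¹ P` on `X` (embedded in `Ĥ`) is a prime convex subset of `X`. -/
def primeFamily : Set (Set D.Hat) :=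
  {P | ∀ g : D.Hat, MedianSet.IsPrimeConvex {x : X | g * D.emb x ∈ P}}

/-- The complement in `Ĥ`, as an involution of `𝔖`. -/
def primeCompl (P : D.primeFamily) : D.primeFamily :=
  ⟨(P : Set D.Hat)ᶜ, fun g => (P.2 g).compl⟩

/-- The left translate `g P = {g v | v ∈ P} = {w | g⁻¹ w ∈ P}` of a member of `𝔖`. -/
def translate (g : D.Hat) (P : D.primeFamily) : D.primeFamily :=
  ⟨{w | g⁻¹ * w ∈ (P : Set D.Hat)}, fun k => by
    have h := P.2 (g⁻¹ * k)
    simp only [mul_assoc] at h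
    exact h⟩

/-- The action of `Ĥ` on `𝔖` by left translations. -/
instance : MulAction D.Hat D.primeFamily where
  smul := D.translate
  one_smul P := Subtype.ext (by
    change {w | (1 : D.Hat)⁻¹ * w ∈ (P : Set D.Hat)} = _
    simp)
  mul_smul g k P := Subtype.ext (by
    change {w | (g * k)⁻¹ * w ∈ (P : Set D.Hat)} = {w | k⁻¹ * (g⁻¹ * w) ∈ (P : Set D.Hat)}
    simp only [mul_inv_rev, mul_assoc])

theorem coe_smul_prime (g : D.Hat) (P : D.primeFamily) :
    ((g • P : D.primeFamily) : Set D.Hat) = {w | g⁻¹ * w ∈ (P : Set D.Hat)} := rfl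

theorem smul_primeCompl (g : D.Hat) (P : D.primeFamily) :
    g • D.primeCompl P = D.primeCompl (g • P) := rfl

/-- The negation `¬ M = {P ∈ 𝔖 | Ĥ \ P ∉ M}` of a subset `M` of `𝔖`. -/
def neg (M : Set D.primeFamily) : Set D.primeFamily :=
  {P | D.primeCompl P ∉ M}

/-- The subset `𝔘(g) = {P ∈ 𝔖 | g ∉ P}` of `𝔖`. -/
def basic (g : D.Hat) : Set D.primeFamily :=
  {P | g ∉ (P : Set D.Hat)}

/-- The lattice `𝔏` of subsets of `𝔖` generated, under binary unions and intersections, by the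
sets `𝔘(g)`. -/
def lattice : Set (Set D.primeFamily) :=
  latticeClosure (Set.range D.basic)

/-- The translate `g M = {g P | P ∈ M} = {P | g⁻¹ P ∈ M}` of a subset `M` of `𝔖`. -/
def translateSet (g : D.Hat) (M : Set D.primeFamily) : Set D.primeFamily :=
  {P | g⁻¹ • P ∈ M}

theorem translateSet_eq_image (g : D.Hat) (M : Set D.primeFamily) :
    D.translateSet g M = (fun P => g • P) '' M := by
  ext P
  constructor
  · intro h
    exact ⟨g⁻¹ • P, h, smul_inv_smul g P⟩
  · rintro ⟨Q, hQ, rfl⟩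
    change g⁻¹ • g • Q ∈ M
    rwa [inv_smul_smul]

theorem translateSet_basic (g k : D.Hat) : D.translateSet g (D.basic k) = D.basic (g * k) := by
  ext P
  change ¬ (g⁻¹⁻¹ * k ∈ (P : Set D.Hat)) ↔ ¬ (g * k ∈ (P : Set D.Hat))
  rw [inv_inv]

theorem translateSet_mem_lattice (g : D.Hat) {M : Set D.primeFamily} (hM : M ∈ D.lattice) :
    D.translateSet g M ∈ D.lattice := by
  refine latticeClosure_sup_inf_induction (s := Set.range D.basic)
    (p := fun M _ => D.translateSet g M ∈ D.lattice) ?_ ?_ ?_ hM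
  · rintro _ ⟨k, rfl⟩
    rw [translateSet_basic]
    exact subset_latticeClosure ⟨_, rfl⟩
  · intro a _ b _ ha hb
    exact isSublattice_latticeClosure.supClosed ha hb
  · intro a _ b _ ha hb
    exact isSublattice_latticeClosure.infClosed ha hb

theorem neg_translateSet (g : D.Hat) (M : Set D.primeFamily) :
    D.neg (D.translateSet g M) = D.translateSet g (D.neg M) := rfl

theorem neg_basic (g : D.Hat) : D.neg (D.basic g) = D.basic g := by
  ext P
  change ¬ (g ∉ ((P : Set D.Hat)ᶜ)) ↔ g ∉ (P : Set D.Hat)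
  simp

/-- The canonical median operation on subsets of `𝔖`. -/
def medSet (A B C : Set D.primeFamily) : Set D.primeFamily :=
  (A ∩ B) ∪ (B ∩ C) ∪ (C ∩ A)

theorem medSet_mem_lattice {A B C : Set D.primeFamily} (hA : A ∈ D.lattice) (hB : B ∈ D.lattice)
    (hC : C ∈ D.lattice) : D.medSet A B C ∈ D.lattice := by
  have hs : SupClosed D.lattice := isSublattice_latticeClosure.supClosed
  have hi : InfClosed D.lattice := isSublattice_latticeClosure.infClosed
  exact hs (hs (hi hA hB) (hi hB hC)) (hi hC hA)

theorem neg_medSet (A B C : Set D.primeFamily) :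
    D.neg (D.medSet A B C) = D.medSet (D.neg A) (D.neg B) (D.neg C) := by
  ext P
  simp only [neg, medSet, Set.mem_ofPred_eq, Set.mem_union, Set.mem_inter_iff]
  tauto

/-- The underlying set `X̂` of the relatively-transitive closure: the elements of the lattice `𝔏`
which are fixed by the negation. -/
def Closure : Type (max u v) := {M : Set D.primeFamily // M ∈ D.lattice ∧ D.neg M = M}

instance : MedianSet D.Closure where
  med A B C := ⟨D.medSet A.1 B.1 C.1, D.medSet_mem_lattice A.2.1 B.2.1 C.2.1, by
    rw [neg_medSet, A.2.2, B.2.2, C.2.2]⟩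
  med_swap_left A B C := Subtype.ext (by
    ext P
    simp only [medSet, Set.mem_union, Set.mem_inter_iff]
    tauto)
  med_swap_right A B C := Subtype.ext (by
    ext P
    simp only [medSet, Set.mem_union, Set.mem_inter_iff]
    tauto)
  med_absorb A B := Subtype.ext (by
    ext P
    simp only [medSet, Set.mem_union, Set.mem_inter_iff]
    tauto)
  med_distrib A B C S T := Subtype.ext (by
    ext P
    simp only [medSet, Set.mem_union, Set.mem_inter_iff]
    tauto)

/-- The action of `Ĥ` on `X̂` induced by left translations. -/
instance : MulAction D.Hat D.Closure where
  smul g M := ⟨D.translateSet g M.1, D.translateSet_mem_lattice g M.2.1, by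
    rw [neg_translateSet, M.2.2]⟩
  one_smul M := Subtype.ext (by
    change {P | (1 : D.Hat)⁻¹ • P ∈ M.1} = M.1
    simp)
  mul_smul g k M := Subtype.ext (by
    change {P | (g * k)⁻¹ • P ∈ M.1} = {P | k⁻¹ • g⁻¹ • P ∈ M.1}
    simp only [mul_inv_rev, mul_smul])

/-- The base point `𝔘(1)` of `X̂`. -/
def basePoint : D.Closure := ⟨D.basic 1, subset_latticeClosure ⟨1, rfl⟩, D.neg_basic 1⟩

end OrbitReps

/-! ### Prime convex subsets separate the points of a median set -/

namespace MedianSet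

variable {X : Type v} [MedianSet X]

/-! Prime convex sets turn medians into majority votes and, by a Zorn argument, separate points
(`exists_primeConvex_separating`). Thus a point of a median set is known once its position relative
to every prime convex set is known.

Universal property. By `medianGenerated_of_neg_eq`, the self-dual elements of the lattice are
exactly iterated medians of the sets `𝔘(g)`. If a map `f : Ĥ → Y` preserves medians on every
translate of `X`, it pulls prime convex sets of `Y` back into `𝔖`, and reading `M` on these
pullbacks singles out one point of `Y`; this extends `f` to `X̂` (`extend`). A morphism `ψ` with
image in one orbit extends to a group morphism `φ` on `Ĥ = H * F`, because `F` is free, and `g ↦ φ g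
• ψ b₁` is such an `f`. Uniqueness holds because the `𝔘(g)` form one orbit and generate `X̂`, while
freeness of the target determines the group morphism on generators.

Freeness. `Ĥ` acts on the Bass–Serre tree of the free product, made explicit by reduced paths. The
projection `gate : Ĥ → X` is equivariant on `H` and constant on every translate of `X` other than
`X`, so it preserves medians on translates and extends to an `H`-equivariant retraction of `X̂` onto
`X`. The retraction makes `X → X̂` injective and excludes fixed points of nontrivial elements of
`H`. Up to conjugation any other `g` has an axis through `X`, with `gate g ≠ gate g⁻¹`
(`exists_conj`). Pulling back along `gate` a prime convex `Q` that separates these two points gives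
`P ∈ 𝔖` whose translates `g ^ n • P` eventually contain any given element of `Ĥ`, hence eventually
avoid any given `M` in the lattice. If `g` fixes a self-dual `M`, then neither `P` nor its
complement is in `M`, a contradiction (`eq_one_of_smul_eq`). -/

theorem med_self_left (x y : X) : med x x y = x := by
  rw [med_swap_right, med_absorb]

/-- The operation `med · · z` is associative and commutative. -/
theorem med_right_comm (x y s z : X) : med (med x y z) s z = med (med x s z) y z := by
  rw [med_swap_right x y z, med_distrib, med_swap_right z s z, med_self_left,
    med_swap_right _ z y]

theorem med_idem_right (x y z : X) : med (med x y z) y z = med x y z := by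
  rw [med_swap_left x y z, med_right_comm, med_self_left]

theorem med_idem_left (x y z : X) : med (med x y z) x z = med x y z := by
  rw [med_right_comm, med_self_left]

/-- Filters of the meet-semilattice with operation `med · · z`. -/
structure IsFilter (z : X) (F : Set X) : Prop where
  inter : ∀ x y, x ∈ F → y ∈ F → med x y z ∈ F
  upward : ∀ x y, x ∈ F → med x y z = x → y ∈ F

/-- In the order of the semilattice, `med u v z` lies below `med u v w` for every `w`. -/
theorem IsFilter.isConvex {z : X} {F : Set X} (hF : IsFilter z F) : IsConvex F := by
  intro u v w hu hv
  refine hF.upward _ _ (hF.inter u v hu hv) ?_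
  rw [med_swap_left, med_distrib, med_swap_left u, med_idem_left, med_swap_left v,
    med_idem_right, med_self_left]

theorem isFilter_principal (y z : X) : IsFilter z {x | med y x z = y} where
  inter a b ha hb := by
    change med y (med a b z) z = y
    rw [med_swap_left, med_right_comm, med_swap_left a y]
    change med y a z = y at ha
    change med y b z = y at hb
    rw [ha, hb]
  upward a b ha hb := by
    change med y a z = y at ha
    change med y b z = y
    rw [← ha, med_swap_left y a, med_right_comm, hb]

/-- The filter generated by a filter and a point. -/
theorem IsFilter.adjoin {z : X} {F : Set X} (hF : IsFilter z F) (p : X) :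
    IsFilter z {x | ∃ a ∈ F, med (med a p z) x z = med a p z} where
  inter x y := by
    rintro ⟨a, ha, hx⟩ ⟨b, hb, hy⟩
    refine ⟨med a b z, hF.inter a b ha hb, ?_⟩
    have h1 : med (med (med a b z) p z) x z = med (med a b z) p z := by
      rw [med_right_comm a b p, med_right_comm _ b x, hx]
    have h2 : med (med (med a b z) p z) y z = med (med a b z) p z := by
      rw [med_swap_left a b, med_right_comm b a p, med_right_comm _ a y, hy]
    have h3 := (isFilter_principal (med (med a b z) p z) z).inter x y h1 h2
    exact h3
  upward x y := by
    rintro ⟨a, ha, hx⟩ hy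
    exact ⟨a, ha, (isFilter_principal (med a p z) z).upward x y hx hy⟩

/-- The point `z` is the bottom of the semilattice `med · · z`, so a maximal filter avoiding `z` is
an ultrafilter: every `p` outside it has meet `z` with some member. This makes its complement
convex. -/
theorem exists_primeConvex_separating {y z : X} (h : y ≠ z) :
    ∃ Q : Set X, IsPrimeConvex Q ∧ y ∈ Q ∧ z ∉ Q := by
  obtain ⟨F, hyF, hF⟩ := zorn_subset_nonempty {F : Set X | IsFilter z F ∧ z ∉ F} (by
    intro c hc hchain ⟨F₀, hF₀⟩
    refine ⟨⋃₀ c, ⟨⟨?_, ?_⟩, ?_⟩, fun s hs => Set.subset_sUnion_of_mem hs⟩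
    · rintro a b ⟨A, hA, ha⟩ ⟨B, hB, hb⟩
      rcases hchain.total hA hB with hAB | hAB
      · exact ⟨B, hB, (hc hB).1.inter a b (hAB ha) hb⟩
      · exact ⟨A, hA, (hc hA).1.inter a b ha (hAB hb)⟩
    · rintro a b ⟨A, hA, ha⟩ hab
      exact ⟨A, hA, (hc hA).1.upward a b ha hab⟩
    · rintro ⟨A, hA, ha⟩
      exact (hc hA).2 ha) {x | med y x z = y}
    ⟨isFilter_principal y z, fun hz => h (by
      change med y z z = y at hz
      rw [← hz, med_swap_left, med_absorb])⟩
  have key : ∀ p, p ∉ F → ∃ a ∈ F, med a p z = z := by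
    intro p hp
    by_contra! hcon
    -- If no member of `F` met `p` in `z`, adjoining `p` would give a filter still avoiding `z`;
    -- maximality then puts `p` in `F`.
    have hle : F ⊆ {x | ∃ a ∈ F, med (med a p z) x z = med a p z} := fun a ha =>
      ⟨a, ha, by rw [med_idem_left]⟩
    refine hp (hF.le_of_ge ⟨hF.prop.1.adjoin p, ?_⟩ hle
      ⟨y, hyF (med_absorb y z ▸ med_self_left y z), by rw [med_idem_right]⟩)
    rintro ⟨a, ha, haz⟩
    refine hcon a ha ?_
    rw [← haz, med_swap_left, med_absorb]
  refine ⟨F, ⟨hF.prop.1.isConvex, ?_⟩, hyF (med_self_left y z), hF.prop.2⟩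
  intro p q w hp hq hr
  obtain ⟨a, ha, hap⟩ := key p hp
  obtain ⟨b, hb, hbq⟩ := key q hq
  have h1 := hF.prop.1.inter _ _ (hF.prop.1.inter _ _ hr ha) hb
  -- Meeting with `a` kills `p` and meeting with `b` kills `q`; two of the three arguments become
  -- `z`.
  have h2 : med (med (med p q w) a z) b z = z := by
    rw [med_distrib p q w a z, med_swap_left p a, hap, med_distrib, med_absorb z b,
      med_right_comm q, med_swap_left q b, hbq, med_absorb, med_self_left]
  exact hF.prop.2 (h2 ▸ h1)

theorem IsPrimeConvex.med_mem_iff {Q : Set X} (hQ : IsPrimeConvex Q) (x y z : X) :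
    med x y z ∈ Q ↔ (x ∈ Q ∧ y ∈ Q) ∨ (y ∈ Q ∧ z ∈ Q) ∨ (z ∈ Q ∧ x ∈ Q) := by
  have key : ∀ {Q : Set X}, IsConvex Q →
      (x ∈ Q ∧ y ∈ Q) ∨ (y ∈ Q ∧ z ∈ Q) ∨ (z ∈ Q ∧ x ∈ Q) → med x y z ∈ Q := by
    rintro Q hQ (⟨h1, h2⟩ | ⟨h1, h2⟩ | ⟨h1, h2⟩)
    · exact hQ _ _ _ h1 h2
    · rw [med_swap_left, med_swap_right]
      exact hQ _ _ _ h1 h2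
    · rw [med_swap_right, med_swap_left]
      exact hQ _ _ _ h1 h2
  refine ⟨fun h => ?_, key hQ.1⟩
  by_contra hcon
  refine key hQ.2 ?_ h
  simp only [Set.mem_compl_iff]
  tauto

theorem IsPrimeConvex.preimage {Y : Type v'} [MedianSet Y] {Q : Set Y} (hQ : IsPrimeConvex Q)
    {f : X → Y} (hf : ∀ x y z, f (med x y z) = med (f x) (f y) (f z)) :
    IsPrimeConvex (f ⁻¹' Q) := by
  constructor
  · intro x y z hx hy
    rw [Set.mem_preimage, hf]
    exact hQ.1 _ _ _ hx hy
  · intro x y z hx hy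
    rw [← Set.preimage_compl, Set.mem_preimage, hf]
    exact hQ.2 _ _ _ hx hy

theorem eq_of_forall_primeConvex {x y : X}
    (h : ∀ Q : Set X, IsPrimeConvex Q → (x ∈ Q ↔ y ∈ Q)) : x = y := by
  by_contra hne
  obtain ⟨Q, hQ, hx, hy⟩ := exists_primeConvex_separating hne
  exact hy ((h Q hQ).1 hx)

end MedianSet

/-! ### Self-dual lattice elements as iterated medians, and extension of maps to `X̂` -/

namespace OrbitReps

open MedianSet

variable {H : Type u} {X : Type v} [Group H] [MedianSet X] [MulAction H X] (D : OrbitReps H X)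

/-- The subsets of `𝔖` obtained from the sets `𝔘(g)` by iterated medians. -/
inductive MedianGenerated : Set D.primeFamily → Prop
  | basic (g : D.Hat) : MedianGenerated (D.basic g)
  | med {A B C : Set D.primeFamily} : MedianGenerated A → MedianGenerated B →
      MedianGenerated C → MedianGenerated (D.medSet A B C)

theorem mem_medSet {A B C : Set D.primeFamily} {P : D.primeFamily} :
    P ∈ D.medSet A B C ↔ (P ∈ A ∧ P ∈ B ∨ P ∈ B ∧ P ∈ C) ∨ P ∈ C ∧ P ∈ A := Iff.rfl

/-- Median interpolation: `T` computes `M` or its negation where `s` and `t` differ, and the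
meet or join of the sets `𝔘(e)`, `e ∈ E`, where they agree. -/
def Interpolates (E : List D.Hat) (M s t T : Set D.primeFamily) : Prop :=
  ∀ P, (P ∉ s → P ∈ t → (P ∈ T ↔ P ∈ M)) ∧ (P ∈ s → P ∉ t → (P ∈ T ↔ P ∈ D.neg M)) ∧
    (P ∈ s → P ∈ t → (P ∈ T ↔ ∃ e ∈ E, P ∈ D.basic e)) ∧
    (P ∉ s → P ∉ t → (P ∈ T ↔ ∀ e ∈ E, P ∈ D.basic e))

theorem mem_medSet_of_mem {A B C : Set D.primeFamily} {P : D.primeFamily} (h : P ∈ C) :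
    P ∈ D.medSet A B C ↔ P ∈ A ∨ P ∈ B := by
  rw [mem_medSet]
  tauto

theorem mem_medSet_of_notMem {A B C : Set D.primeFamily} {P : D.primeFamily} (h : P ∉ C) :
    P ∈ D.medSet A B C ↔ P ∈ A ∧ P ∈ B := by
  rw [mem_medSet]
  tauto

theorem neg_sup (A B : Set D.primeFamily) : D.neg (A ⊔ B) = D.neg A ⊓ D.neg B := by
  ext P
  exact not_or

theorem neg_inf (A B : Set D.primeFamily) : D.neg (A ⊓ B) = D.neg A ⊔ D.neg B := by
  ext P
  exact not_and_or

theorem neg_mem_lattice {M : Set D.primeFamily} (hM : M ∈ D.lattice) :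
    D.neg M ∈ D.lattice := by
  refine latticeClosure_sup_inf_induction (s := Set.range D.basic)
    (p := fun M _ => D.neg M ∈ D.lattice) ?_ ?_ ?_ hM
  · rintro _ ⟨k, rfl⟩
    rw [neg_basic]
    exact subset_latticeClosure ⟨_, rfl⟩
  · intro a _ b _ ha hb
    rw [neg_sup]
    exact isSublattice_latticeClosure.infClosed ha hb
  · intro a _ b _ ha hb
    rw [neg_inf]
    exact isSublattice_latticeClosure.supClosed ha hb

/-- A median with third argument `t` is a join where `t` holds and a meet elsewhere. Unions and
intersections can therefore be imitated by medians wherever `s` and `t` differ. The list `E`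
collects the generators occurring in `M`; `M` holds where they all hold and fails where they all
fail. -/
theorem exists_interpolates {M : Set D.primeFamily} (hM : M ∈ D.lattice) :
    ∃ E : List D.Hat, E ≠ [] ∧
      (∀ P, (∀ e ∈ E, P ∈ D.basic e) → P ∈ M) ∧ (∀ P, (∀ e ∈ E, P ∉ D.basic e) → P ∉ M) ∧
      ∀ s t, D.MedianGenerated s → D.MedianGenerated t →
        ∃ T, D.MedianGenerated T ∧ D.Interpolates E M s t T := by
  refine latticeClosure_sup_inf_induction (s := Set.range D.basic)
    (p := fun M _ => ∃ E : List D.Hat, E ≠ [] ∧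
      (∀ P, (∀ e ∈ E, P ∈ D.basic e) → P ∈ M) ∧ (∀ P, (∀ e ∈ E, P ∉ D.basic e) → P ∉ M) ∧
      ∀ s t, D.MedianGenerated s → D.MedianGenerated t →
        ∃ T, D.MedianGenerated T ∧ D.Interpolates E M s t T) ?_ ?_ ?_ hM
  · rintro _ ⟨k, rfl⟩
    refine ⟨[k], by simp, by simp, by simp, fun s t _ _ => ⟨_, .basic k, fun P => ?_⟩⟩
    simp [neg_basic]
  · rintro A _ B _ ⟨E, hE, hA1, hA0, hA⟩ ⟨E', hE', hB1, hB0, hB⟩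
    refine ⟨E ++ E', by simp [hE], fun P hP => Or.inl (hA1 P fun e he => hP e (by simp [he])),
      fun P hP h => h.elim (hA0 P fun e he => hP e (by simp [he]))
        (hB0 P fun e he => hP e (by simp [he])), fun s t hs ht => ?_⟩
    obtain ⟨T, hT, hAT⟩ := hA s t hs ht
    obtain ⟨T', hT', hBT⟩ := hB s t hs ht
    -- Where `t` holds and `s` fails this is the join, as wanted for `A ⊔ B`; where `s` holds and
    -- `t` fails it is the meet, as wanted for the negation.
    refine ⟨D.medSet T T' t, .med hT hT' ht, fun P => ?_⟩
    obtain ⟨a1, a2, a3, a4⟩ := hAT P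
    obtain ⟨b1, b2, b3, b4⟩ := hBT P
    have hex : (∃ e ∈ E ++ E', P ∈ D.basic e) ↔
        (∃ e ∈ E, P ∈ D.basic e) ∨ ∃ e ∈ E', P ∈ D.basic e := by
      simp only [List.mem_append, or_and_right, exists_or]
    have hall : (∀ e ∈ E ++ E', P ∈ D.basic e) ↔
        (∀ e ∈ E, P ∈ D.basic e) ∧ ∀ e ∈ E', P ∈ D.basic e := by
      simp only [List.mem_append, or_imp, forall_and]
    refine ⟨fun h1 h2 => (D.mem_medSet_of_mem h2).trans (or_congr (a1 h1 h2) (b1 h1 h2)),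
      fun h1 h2 => ?_,
      fun h1 h2 => (D.mem_medSet_of_mem h2).trans ((or_congr (a3 h1 h2) (b3 h1 h2)).trans hex.symm),
      fun h1 h2 =>
        (D.mem_medSet_of_notMem h2).trans ((and_congr (a4 h1 h2) (b4 h1 h2)).trans hall.symm)⟩
    rw [neg_sup]
    exact (D.mem_medSet_of_notMem h2).trans (and_congr (a2 h1 h2) (b2 h1 h2))
  · rintro A _ B _ ⟨E, hE, hA1, hA0, hA⟩ ⟨E', hE', hB1, hB0, hB⟩
    refine ⟨E ++ E', by simp [hE], fun P hP => ⟨hA1 P fun e he => hP e (by simp [he]),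
      hB1 P fun e he => hP e (by simp [he])⟩,
      fun P hP h => hA0 P (fun e he => hP e (by simp [he])) h.1, fun s t hs ht => ?_⟩
    obtain ⟨T, hT, hAT⟩ := hA s t hs ht
    obtain ⟨T', hT', hBT⟩ := hB s t hs ht
    -- The roles of `s` and `t` are exchanged: a meet where only `t` holds, a join where only `s`
    -- holds.
    refine ⟨D.medSet T T' s, .med hT hT' hs, fun P => ?_⟩
    obtain ⟨a1, a2, a3, a4⟩ := hAT P
    obtain ⟨b1, b2, b3, b4⟩ := hBT P
    have hex : (∃ e ∈ E ++ E', P ∈ D.basic e) ↔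
        (∃ e ∈ E, P ∈ D.basic e) ∨ ∃ e ∈ E', P ∈ D.basic e := by
      simp only [List.mem_append, or_and_right, exists_or]
    have hall : (∀ e ∈ E ++ E', P ∈ D.basic e) ↔
        (∀ e ∈ E, P ∈ D.basic e) ∧ ∀ e ∈ E', P ∈ D.basic e := by
      simp only [List.mem_append, or_imp, forall_and]
    refine ⟨fun h1 h2 => (D.mem_medSet_of_notMem h1).trans (and_congr (a1 h1 h2) (b1 h1 h2)),
      fun h1 h2 => ?_,
      fun h1 h2 => (D.mem_medSet_of_mem h1).trans ((or_congr (a3 h1 h2) (b3 h1 h2)).trans hex.symm),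
      fun h1 h2 =>
        (D.mem_medSet_of_notMem h1).trans ((and_congr (a4 h1 h2) (b4 h1 h2)).trans hall.symm)⟩
    rw [neg_inf]
    exact (D.mem_medSet_of_mem h1).trans (or_congr (a2 h1 h2) (b2 h1 h2))

/-- Self-duality makes the interpolant equal to `M` wherever `s` and `t` disagree, in either
direction. Feeding in the generators one at a time leaves only the `P` on which all generators in
`E` agree, and there their common value is that of `M`. -/
theorem medianGenerated_of_neg_eq {M : Set D.primeFamily} (hM : M ∈ D.lattice)
    (hneg : D.neg M = M) : D.MedianGenerated M := by
  obtain ⟨E, hE, h1, h0, hT⟩ := D.exists_interpolates hM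
  have step : ∀ l : List D.Hat, l ≠ [] → l ⊆ E → ∃ V, D.MedianGenerated V ∧
      ∀ P, (P ∈ V ↔ P ∈ M) ∨ ∀ e ∈ l, (P ∈ D.basic e ↔ P ∈ V) := by
    intro l
    induction l with
    | nil => simp
    | cons x l ih =>
      intro _ hl
      have hx : x ∈ E := hl (by simp)
      rcases eq_or_ne l [] with rfl | hl'
      · exact ⟨_, .basic x, fun P => Or.inr (by simp)⟩
      obtain ⟨V, hV, hVM⟩ := ih hl' fun e he => hl (by simp [he])
      -- Where `V` and `𝔘(x)` disagree, `T` equals `M`; where they agree, `T` keeps their common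
      -- value because `x ∈ E`.
      obtain ⟨T, hT, hI⟩ := hT V (D.basic x) hV (.basic x)
      refine ⟨T, hT, fun P => ?_⟩
      obtain ⟨a1, a2, a3, a4⟩ := hI P
      rw [hneg] at a2
      by_cases hPV : P ∈ V <;> by_cases hPx : P ∈ D.basic x
      · have hPT : P ∈ T := (a3 hPV hPx).2 ⟨x, hx, hPx⟩
        refine (hVM P).imp (fun h => iff_of_true hPT (h.1 hPV)) fun h e he => ?_
        rcases List.mem_cons.1 he with rfl | he
        · exact iff_of_true hPx hPT
        · exact (h e he).trans (iff_of_true hPV hPT)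
      · exact Or.inl (a2 hPV hPx)
      · exact Or.inl (a1 hPV hPx)
      · have hPT : P ∉ T := fun h => hPx ((a4 hPV hPx).1 h x hx)
        refine (hVM P).imp (fun h => iff_of_false hPT (mt h.2 hPV)) fun h e he => ?_
        rcases List.mem_cons.1 he with rfl | he
        · exact iff_of_false hPx hPT
        · exact (h e he).trans (iff_of_false hPV hPT)
  obtain ⟨V, hV, hVM⟩ := step E hE fun _ => id
  suffices V = M from this ▸ hV
  ext P
  rcases hVM P with h | h
  · exact h
  by_cases hPV : P ∈ V
  · exact iff_of_true hPV (h1 P fun e he => (h e he).2 hPV)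
  · exact iff_of_false hPV (h0 P fun e he => fun h' => hPV ((h e he).1 h'))

/-- The point `𝔘(g)` of `X̂`. -/
def basicPoint (g : D.Hat) : D.Closure :=
  ⟨D.basic g, subset_latticeClosure ⟨g, rfl⟩, D.neg_basic g⟩

theorem smul_basicPoint (g k : D.Hat) : g • D.basicPoint k = D.basicPoint (g * k) :=
  Subtype.ext (D.translateSet_basic g k)

theorem smul_basePoint (g : D.Hat) : g • D.basePoint = D.basicPoint g :=
  (D.smul_basicPoint g 1).trans (by rw [mul_one])

/-- `X̂` is generated, as a median set, by the points `𝔘(g)`. -/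
theorem closure_induction {p : D.Closure → Prop} (hb : ∀ g, p (D.basicPoint g))
    (hm : ∀ A B C, p A → p B → p C → p (MedianSet.med A B C)) (M : D.Closure) : p M := by
  have key : ∀ M, D.MedianGenerated M → ∃ h, p ⟨M, h⟩ := by
    intro M hM
    induction hM with
    | basic g => exact ⟨_, hb g⟩
    | med _ _ _ hA hB hC =>
      obtain ⟨_, hA⟩ := hA
      obtain ⟨_, hB⟩ := hB
      obtain ⟨_, hC⟩ := hC
      exact ⟨_, hm _ _ _ hA hB hC⟩
  exact (key M.1 (D.medianGenerated_of_neg_eq M.2.1 M.2.2)).2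

section Extension

variable {Y : Type v'} [MedianSet Y] (f : D.Hat → Y)
  (hf : ∀ (g : D.Hat) (x y z : X), f (g * D.emb (med x y z)) =
    med (f (g * D.emb x)) (f (g * D.emb y)) (f (g * D.emb z)))

/-- The pullback to `Ĥ` of a prime convex set. -/
def pullback (Q : {Q : Set Y // IsPrimeConvex Q}) : D.primeFamily :=
  ⟨f ⁻¹' Q.1, fun g => Q.2.preimage (f := fun x => f (g * D.emb x)) (hf g)⟩

/-- Both sides follow the majority rule under medians, so it suffices to know the point `f g` for
each generator `𝔘(g)`. -/
theorem exists_extend (M : D.Closure) :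
    ∃ y : Y, ∀ Q : {Q : Set Y // IsPrimeConvex Q}, D.pullback f hf Q ∈ M.1 ↔ y ∉ Q.1 := by
  induction M using D.closure_induction with
  | hb g => exact ⟨f g, fun Q => Iff.rfl⟩
  | hm A B C hA hB hC =>
    obtain ⟨a, ha⟩ := hA
    obtain ⟨b, hb⟩ := hB
    obtain ⟨c, hc⟩ := hC
    refine ⟨med a b c, fun Q => ?_⟩
    change _ ∈ D.medSet _ _ _ ↔ _
    rw [mem_medSet, ha, hb, hc, Q.2.med_mem_iff]
    tauto

/-- The extension to `X̂` of a map on `Ĥ` which preserves the medians of the translates of `X`. -/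
noncomputable def extend (M : D.Closure) : Y := (D.exists_extend f hf M).choose

theorem pullback_mem_iff (M : D.Closure) (Q : {Q : Set Y // IsPrimeConvex Q}) :
    D.pullback f hf Q ∈ M.1 ↔ D.extend f hf M ∉ Q.1 :=
  (D.exists_extend f hf M).choose_spec Q

theorem extend_eq {M : D.Closure} {y : Y}
    (h : ∀ Q : {Q : Set Y // IsPrimeConvex Q}, D.pullback f hf Q ∈ M.1 ↔ y ∉ Q.1) :
    D.extend f hf M = y :=
  eq_of_forall_primeConvex fun Q hQ =>
    not_iff_not.1 ((D.pullback_mem_iff f hf M ⟨Q, hQ⟩).symm.trans (h ⟨Q, hQ⟩))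

theorem extend_basicPoint (g : D.Hat) : D.extend f hf (D.basicPoint g) = f g :=
  D.extend_eq f hf fun _ => Iff.rfl

theorem extend_med (A B C : D.Closure) : D.extend f hf (med A B C) =
    med (D.extend f hf A) (D.extend f hf B) (D.extend f hf C) := by
  refine D.extend_eq f hf fun Q => ?_
  change _ ∈ D.medSet _ _ _ ↔ _
  rw [mem_medSet, D.pullback_mem_iff f hf, D.pullback_mem_iff f hf, D.pullback_mem_iff f hf,
    Q.2.med_mem_iff]
  tauto

end Extension

instance isMedianAction_closure : IsMedianAction D.Hat D.Closure where
  smul_med _ _ _ _ := rfl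

theorem pow_smul_mem_iff {g : D.Hat} {M : D.Closure} (hM : g • M = M) (n : ℕ)
    (P : D.primeFamily) : g ^ n • P ∈ M.1 ↔ P ∈ M.1 := by
  induction n with
  | zero => rw [pow_zero, one_smul]
  | succ n ih =>
    have h : ∀ Q : D.primeFamily, g • Q ∈ M.1 ↔ Q ∈ M.1 := fun Q => by
      have h1 : g • Q ∈ (g • M).1 ↔ g⁻¹ • g • Q ∈ M.1 := Iff.rfl
      rwa [hM, inv_smul_smul] at h1
    rw [pow_succ', mul_smul, h, ih]

/-- Each `P ∈ 𝔖` has a prime convex trace on `X`, hence obeys the majority rule there. -/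
theorem basicPoint_emb_med (x y z : X) : D.basicPoint (D.emb (med x y z)) =
    med (D.basicPoint (D.emb x)) (D.basicPoint (D.emb y)) (D.basicPoint (D.emb z)) := by
  refine Subtype.ext (Set.ext fun P => ?_)
  have h := (P.2 1).compl.med_mem_iff x y z
  simp only [one_mul] at h
  change D.emb (med x y z) ∉ P.1 ↔ P ∈ D.medSet _ _ _
  rw [mem_medSet, or_assoc]
  exact h

theorem basicPoint_mem_orbit (g k : D.Hat) :
    D.basicPoint g ∈ MulAction.orbit D.Hat (D.basicPoint k) :=
  ⟨g * k⁻¹, by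
    change (g * k⁻¹) • D.basicPoint k = _
    rw [smul_basicPoint, inv_mul_cancel_right]⟩

theorem map_basicPoint {K : Type v'} {Y : Type v''} [Group K] [MedianSet Y]
    [MulAction K Y] (Ψ : ActHom D.Hat D.Closure K Y) (g : D.Hat) :
    Ψ.map (D.basicPoint g) = Ψ.groupHom g • Ψ.map (D.basicPoint 1) := by
  rw [← Ψ.map_smul, smul_basicPoint, mul_one]

end OrbitReps

/-! ### Normal forms in `Ĥ` from its action on reduced paths -/

namespace OrbitReps

variable {H : Type u} {X : Type v} [Group H] [MulAction H X] (D : OrbitReps H X)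

theorem rep_eq {x b : X} (hb : b ∈ D.reps) (hx : x ∈ MulAction.orbit H b) : D.rep x = b :=
  (D.existsUnique x).unique (D.rep_spec x) ⟨hb, hx⟩

theorem rep_of_mem {b : X} (hb : b ∈ D.reps) : D.rep b = b :=
  D.rep_eq hb (MulAction.mem_orbit_self b)

theorem rep_smul (h : H) (x : X) : D.rep (h • x) = D.rep x :=
  D.rep_eq (D.rep_spec x).1
    (MulAction.mem_orbit_of_mem_orbit h (D.rep_spec x).2)

theorem gen_base : D.gen D.base = 1 := by
  simp [gen]

theorem gen_freeBase (b : D.FreeBase) : D.gen b = Monoid.Coprod.inr (FreeGroup.of b) := by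
  rw [gen, dif_pos b.2]

theorem emb_of_mem [IsCancelSMul H X] {b : X} (hb : b ∈ D.reps) : D.emb b = D.gen b := by
  have h := D.emb_smul_of_mem 1 hb
  rwa [one_smul, map_one, one_mul] at h

theorem emb_base [IsCancelSMul H X] : D.emb D.base = 1 := by
  rw [D.emb_of_mem D.base_mem, gen_base]

theorem emb_smul [IsCancelSMul H X] (h : H) (x : X) :
    D.emb (h • x) = Monoid.Coprod.inl h * D.emb x := by
  rw [← D.coef_smul_rep x, smul_smul, D.emb_smul_of_mem _ (D.rep_spec x).1,
    D.emb_smul_of_mem _ (D.rep_spec x).1, map_mul, mul_assoc]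

theorem hat_induction {p : D.Hat → Prop} (hH : ∀ h : H, p (Monoid.Coprod.inl h))
    (hg : ∀ b ∈ D.reps, p (D.gen b)) (hinv : ∀ g, p g → p g⁻¹)
    (hmul : ∀ g k, p g → p k → p (g * k)) (g : D.Hat) : p g := by
  induction g using Monoid.Coprod.induction_on with
  | inl h => exact hH h
  | inr w =>
    induction w using FreeGroup.induction_on with
    | C1 =>
      have h := hH 1
      rw [map_one] at h
      rwa [map_one]
    | of b => exact D.gen_freeBase b ▸ hg b b.2.1
    | inv_of b hb => rw [map_inv]; exact hinv _ hb
    | mul x y hx hy => rw [map_mul]; exact hmul _ _ hx hy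
  | mul x y hx hy => exact hmul _ _ hx hy

/-! The Bass–Serre tree of `Ĥ` has the translates of `X` and the elements of `Ĥ` as vertices. Its
reduced paths are encoded by lists of pairs `(b, y)`: from a vertex in `Ĥ` enter the translate of
`X` in which that vertex is the point `b`, and leave it at the point `y`. -/

/-- Reduced paths starting at `X`, whose first vertex in `Ĥ` is the image of `x`. -/
def Reduced : X → List (X × X) → Prop
  | _, [] => True
  | x, (b, y) :: l => b ∈ D.reps ∧ b ≠ D.rep x ∧ y ≠ b ∧ Reduced y l

/-- Reduced paths starting at a vertex in `Ĥ`. -/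
def ReducedFromPoint : List (X × X) → Prop
  | [] => True
  | (b, y) :: l => b ∈ D.reps ∧ y ≠ b ∧ D.Reduced y l

/-- Reduced paths starting at `X` and ending at a vertex in `Ĥ`. -/
abbrev Path : Type v := {p : X × List (X × X) // D.Reduced p.1 p.2}

/-- Reduced paths between two vertices in `Ĥ`, up to translation. -/
abbrev PointPath : Type v := {l : List (X × X) // D.ReducedFromPoint l}

theorem reduced_nil (x : X) : D.Reduced x [] := trivial

theorem Reduced.fromPoint {x : X} {l : List (X × X)} (h : D.Reduced x l) :
    D.ReducedFromPoint l := by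
  cases l with
  | nil => trivial
  | cons a l => exact ⟨h.1, h.2.2⟩

theorem Reduced.of_rep_eq {x y : X} {l : List (X × X)} (h : D.Reduced x l)
    (hxy : D.rep y = D.rep x) : D.Reduced y l := by
  cases l with
  | nil => trivial
  | cons a l => exact ⟨h.1, hxy ▸ h.2.1, h.2.2⟩

open scoped Classical in
/-- Prolong a path at its origin, where `X` is entered at the point `b`. -/
noncomputable def prolong (b : D.reps) : D.Path ≃ D.PointPath where
  toFun p := ⟨if p.1.1 = b then p.1.2 else (b.1, p.1.1) :: p.1.2, by
    split_ifs with h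
    · exact Reduced.fromPoint D p.2
    · exact ⟨b.2, h, p.2⟩⟩
  invFun
    | ⟨[], _⟩ => ⟨(b.1, []), D.reduced_nil _⟩
    | ⟨(c, y) :: l, h⟩ => if hc : c = b then ⟨(y, l), h.2.2⟩ else
        ⟨(b.1, (c, y) :: l), h.1, by rwa [D.rep_of_mem b.2], h.2⟩
  left_inv := by
    rintro ⟨⟨x, l⟩, h⟩
    by_cases hx : x = b
    · subst hx
      cases l with
      | nil => simp
      | cons a l =>
        have hb := h.2.1
        simp only [D.rep_of_mem b.2] at hb
        simp [hb]
    · simp [hx]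
  right_inv := by
    rintro ⟨_ | ⟨⟨c, y⟩, l⟩, h⟩
    · simp
    · by_cases hc : c = b
      · subst hc
        simp [h.2.1]
      · simp [hc]

theorem prolong_val_of_ne (b : D.reps) (p : D.Path) (h : p.1.1 ≠ b) :
    (D.prolong b p).1 = (b.1, p.1.1) :: p.1.2 := if_neg h

theorem prolong_val_of_eq (b : D.reps) (p : D.Path) (h : p.1.1 = b) :
    (D.prolong b p).1 = p.1.2 := if_pos h

theorem prolong_symm_val_of_ne (b : D.reps) (c y : X) (l : List (X × X))
    (h : D.ReducedFromPoint ((c, y) :: l)) (hc : c ≠ b) :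
    ((D.prolong b).symm ⟨(c, y) :: l, h⟩).1 = (b.1, (c, y) :: l) := by
  simp [prolong, hc]

/-- The action of `H` on the paths starting at `X`. -/
def pathPerm : H →* Equiv.Perm D.Path where
  toFun h :=
    { toFun p := ⟨(h • p.1.1, p.1.2), Reduced.of_rep_eq D p.2 (D.rep_smul h _)⟩
      invFun p := ⟨(h⁻¹ • p.1.1, p.1.2), Reduced.of_rep_eq D p.2 (D.rep_smul _ _)⟩
      left_inv p := by simp
      right_inv p := by simp }
  map_one' := by
    ext p : 1
    exact Subtype.ext (Prod.ext (one_smul H p.1.1) rfl)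
  map_mul' h k := by
    ext p : 1
    exact Subtype.ext (Prod.ext (mul_smul h k p.1.1) rfl)

/-- The base point, as a representative. -/
def baseRep : D.reps := ⟨D.base, D.base_mem⟩

/-- The action of `Ĥ` on the paths starting at `X`. -/
noncomputable def act : D.Hat →* Equiv.Perm D.Path :=
  Monoid.Coprod.lift D.pathPerm
    (FreeGroup.lift fun b => (D.prolong D.baseRep).trans (D.prolong ⟨b.1, b.2.1⟩).symm)

theorem act_inl (h : H) (p : D.Path) : (D.act (Monoid.Coprod.inl h) p).1 = (h • p.1.1, p.1.2) := by
  rw [act, Monoid.Coprod.lift_apply_inl]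
  rfl

/-- Prolonging at the base point views the path from the vertex `1`; multiplication by `D.gen b`
moves that vertex to the point `b` of `X`, and the path is then read from `X` again. -/
theorem act_gen (b : D.reps) (p : D.Path) :
    D.act (D.gen b) p = (D.prolong b).symm (D.prolong D.baseRep p) := by
  by_cases hb : b.1 = D.base
  · have hb' : b = D.baseRep := Subtype.ext hb
    subst hb'
    rw [hb, gen_base, map_one, Equiv.symm_apply_apply]
    rfl
  · rw [D.gen_freeBase ⟨b.1, b.2, hb⟩, act, Monoid.Coprod.lift_apply_inr, FreeGroup.lift_apply_of]
    rfl

theorem act_gen_inv (b : D.reps) (p : D.Path) :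
    D.act (D.gen b)⁻¹ p = (D.prolong D.baseRep).symm (D.prolong b p) := by
  rw [map_inv, Equiv.Perm.inv_eq_iff_eq, act_gen]
  simp

/-- The element of `Ĥ` at which a path starting at `X` ends. -/
noncomputable def ev : X → List (X × X) → D.Hat
  | x, [] => D.emb x
  | x, (b, y) :: l => D.emb x * (D.gen b)⁻¹ * ev y l

/-- The element of `Ĥ` at which a path starting at `1` ends. -/
noncomputable def evPoint : List (X × X) → D.Hat
  | [] => 1
  | (b, y) :: l => (D.gen b)⁻¹ * D.ev y l

theorem ev_eq (x : X) (l : List (X × X)) : D.ev x l = D.emb x * D.evPoint l := by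
  cases l with
  | nil => exact (mul_one _).symm
  | cons a l => exact mul_assoc _ _ _

/-- The path consisting of the base point. -/
def basePath : D.Path := ⟨(D.base, []), D.reduced_nil _⟩

/-- The path from `X` to an element of `Ĥ`. -/
noncomputable def code (g : D.Hat) : D.Path := D.act g D.basePath

theorem code_mul (g k : D.Hat) : D.code (g * k) = D.act g (D.code k) := by
  rw [code, map_mul]
  rfl

/-- The projection of `Ĥ` to `X`: the point at which the path from `X` to `g` leaves `X`. -/
noncomputable def gate (g : D.Hat) : X := (D.code g).1.1

/-- The length of the path from `X` to `g`. -/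
noncomputable def len (g : D.Hat) : ℕ := (D.code g).1.2.length

theorem gate_inl_mul (h : H) (g : D.Hat) : D.gate (Monoid.Coprod.inl h * g) = h • D.gate g := by
  rw [gate, code_mul, act_inl]
  rfl

/-- Reduced paths from `X` to a translate of `X`, reached at its point `b`. -/
def ReducedEnd : X → List (X × X) → X → Prop
  | x, [], b => b ∈ D.reps ∧ b ≠ D.rep x
  | x, (c, y) :: l, b => c ∈ D.reps ∧ c ≠ D.rep x ∧ y ≠ c ∧ ReducedEnd y l b

variable [IsCancelSMul H X]

theorem evPoint_prolong (b : D.reps) (p : D.Path) :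
    D.evPoint (D.prolong b p).1 = (D.gen b)⁻¹ * D.ev p.1.1 p.1.2 := by
  by_cases h : p.1.1 = b
  · rw [D.prolong_val_of_eq b p h, ev_eq, h, D.emb_of_mem b.2, inv_mul_cancel_left]
  · rw [D.prolong_val_of_ne b p h, evPoint]

theorem ev_prolong_symm (b : D.reps) (q : D.PointPath) :
    D.ev ((D.prolong b).symm q).1.1 ((D.prolong b).symm q).1.2 = D.gen b * D.evPoint q.1 := by
  have h := D.evPoint_prolong b ((D.prolong b).symm q)
  rw [Equiv.apply_symm_apply] at h
  rw [h, mul_inv_cancel_left]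

theorem ev_act (g : D.Hat) (p : D.Path) :
    D.ev (D.act g p).1.1 (D.act g p).1.2 = g * D.ev p.1.1 p.1.2 := by
  induction g using D.hat_induction generalizing p with
  | hH h => rw [act_inl, ev_eq, emb_smul, mul_assoc, ← ev_eq]
  | hg b hb =>
    rw [D.act_gen ⟨b, hb⟩, ev_prolong_symm, evPoint_prolong]
    simp [baseRep, gen_base]
  | hinv g ih =>
    have h := ih (D.act g⁻¹ p)
    rw [← Equiv.Perm.mul_apply, ← map_mul, mul_inv_cancel, map_one, Equiv.Perm.one_apply] at h
    rw [h, inv_mul_cancel_left]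
  | hmul g k hg hk => rw [map_mul, Equiv.Perm.mul_apply, hg, hk, mul_assoc]

/-- Evaluation of paths is equivariant and sends the base path to `1`, so every element of `Ĥ` is
the end of its coded path. -/
theorem ev_code (g : D.Hat) : D.ev (D.code g).1.1 (D.code g).1.2 = g := by
  rw [code, ev_act, basePath, ev, emb_base, mul_one]

end OrbitReps

/-! ### Projections of translates to `X`, and dynamics on the tree -/

namespace OrbitReps

variable {H : Type u} {X : Type v} [Group H] [MulAction H X] {D : OrbitReps H X}

theorem ReducedEnd.mem_reps {x b : X} {l : List (X × X)} (h : D.ReducedEnd x l b) :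
    b ∈ D.reps := by
  induction l generalizing x with
  | nil => exact h.1
  | cons a l ih => exact ih h.2.2.2

theorem ReducedEnd.reduced {x b : X} {l : List (X × X)} (h : D.ReducedEnd x l b) :
    D.Reduced x l := by
  induction l generalizing x with
  | nil => trivial
  | cons a l ih => exact ⟨h.1, h.2.1, h.2.2.1, ih h.2.2.2⟩

theorem ReducedEnd.nontrivial {x b : X} {l : List (X × X)} (h : D.ReducedEnd x l b) :
    ∃ y, y ≠ x := by
  have key : ∀ c ∈ D.reps, c ≠ D.rep x → c ≠ x := by
    rintro c hc hne rfl
    exact hne (D.rep_of_mem hc).symm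
  cases l with
  | nil => exact ⟨b, key b h.1 h.2⟩
  | cons a l => exact ⟨a.1, key a.1 h.1 h.2.1⟩

theorem act_emb_mul_gen_inv (x : X) {b : X} (hb : b ∈ D.reps) (p : D.Path) :
    D.act (D.emb x * (D.gen b)⁻¹) p = D.act (Monoid.Coprod.inl (D.coef x))
      ((D.prolong ⟨D.rep x, (D.rep_spec x).1⟩).symm (D.prolong ⟨b, hb⟩ p)) := by
  rw [emb, mul_assoc, map_mul, map_mul, Equiv.Perm.mul_apply, Equiv.Perm.mul_apply,
    D.act_gen_inv ⟨b, hb⟩, D.act_gen ⟨D.rep x, (D.rep_spec x).1⟩, Equiv.apply_symm_apply]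

theorem act_emb_mul_gen_inv_of_ne {x b : X} (hb : b ∈ D.reps) (hx : b ≠ D.rep x) (p : D.Path)
    (hp : p.1.1 ≠ b) :
    (D.act (D.emb x * (D.gen b)⁻¹) p).1 = (x, (b, p.1.1) :: p.1.2) := by
  have hr : D.ReducedFromPoint ((b, p.1.1) :: p.1.2) := ⟨hb, hp, p.2⟩
  have h1 : D.prolong ⟨b, hb⟩ p = ⟨(b, p.1.1) :: p.1.2, hr⟩ :=
    Subtype.ext (D.prolong_val_of_ne ⟨b, hb⟩ p hp)
  rw [act_emb_mul_gen_inv x hb, act_inl, h1, prolong_symm_val_of_ne _ _ _ _ _ _ hx]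
  exact Prod.ext (D.coef_smul_rep x) rfl

theorem act_emb_mul_gen_inv_nil {x b : X} (hb : b ∈ D.reps) (p : D.Path)
    (hp : p.1 = (b, [])) :
    (D.act (D.emb x * (D.gen b)⁻¹) p).1 = (x, []) := by
  have h1 : D.prolong ⟨b, hb⟩ p = ⟨[], trivial⟩ :=
    Subtype.ext ((D.prolong_val_of_eq ⟨b, hb⟩ p (by rw [hp])).trans (by rw [hp]))
  rw [act_emb_mul_gen_inv x hb, act_inl, h1]
  exact Prod.ext (D.coef_smul_rep x) rfl

theorem ev_cons_mul (x c y : X) (l : List (X × X)) (g : D.Hat) :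
    D.ev x ((c, y) :: l) * g = D.emb x * (D.gen c)⁻¹ * (D.ev y l * g) := by
  rw [ev, mul_assoc]

/-- The translate is entered at `b` and left at a different point, so there is no backtracking and
the paths concatenate. -/
theorem ReducedEnd.act_of_ne {x b : X} {l : List (X × X)} (h : D.ReducedEnd x l b)
    (p : D.Path) (hp : p.1.1 ≠ b) :
    (D.act (D.ev x l * (D.gen b)⁻¹) p).1 = (x, l ++ (b, p.1.1) :: p.1.2) := by
  induction l generalizing x with
  | nil => exact act_emb_mul_gen_inv_of_ne h.1 h.2 p hp
  | cons a l ih =>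
    obtain ⟨c, y⟩ := a
    have h1 := ih h.2.2.2
    rw [ev_cons_mul, map_mul, Equiv.Perm.mul_apply,
      act_emb_mul_gen_inv_of_ne h.1 h.2.1 _ (by rw [h1]; exact h.2.2.1), h1]
    rfl

theorem ReducedEnd.act_nil {x b : X} {l : List (X × X)} (h : D.ReducedEnd x l b)
    (p : D.Path) (hp : p.1 = (b, [])) :
    (D.act (D.ev x l * (D.gen b)⁻¹) p).1 = (x, l) := by
  induction l generalizing x with
  | nil => exact act_emb_mul_gen_inv_nil h.1 p hp
  | cons a l ih =>
    obtain ⟨c, y⟩ := a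
    have h1 := ih h.2.2.2
    rw [ev_cons_mul, map_mul, Equiv.Perm.mul_apply,
      act_emb_mul_gen_inv_of_ne h.1 h.2.1 _ (by rw [h1]; exact h.2.2.1), h1]

variable (D) in
/-- The translate `g X` is joined to `X` by the reduced path given by `x`, `l` and `b`. -/
def Joins (g : D.Hat) (x : X) (l : List (X × X)) (b : X) (h : H) : Prop :=
  D.ReducedEnd x l b ∧ g = D.ev x l * (D.gen b)⁻¹ * Monoid.Coprod.inl h

/-- Only the last step of the path can cancel: this happens when `b` represents the orbit of the
last point, so that the translate reached is the one just left. -/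
theorem exists_joins_of_reduced {x b : X} {l : List (X × X)} (hb : b ∈ D.reps)
    (hl : D.Reduced x l) :
    (∃ h : H, D.ev x l * (D.gen b)⁻¹ = Monoid.Coprod.inl h) ∨
      ∃ l' b' h, l'.length ≤ l.length ∧ D.Joins (D.ev x l * (D.gen b)⁻¹) x l' b' h := by
  induction l generalizing x with
  | nil =>
    by_cases h : b = D.rep x
    · refine Or.inl ⟨D.coef x, ?_⟩
      rw [h, ev, emb, mul_inv_cancel_right]
    · exact Or.inr ⟨[], b, 1, le_rfl, ⟨hb, h⟩, by rw [map_one, mul_one]⟩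
  | cons a l ih =>
    obtain ⟨c, y⟩ := a
    right
    rcases ih hl.2.2.2 with ⟨h, hh⟩ | ⟨l', b', h, hlen, hred, heq⟩
    · exact ⟨[], c, h, Nat.zero_le _, ⟨hl.1, hl.2.1⟩, by rw [ev_cons_mul, hh, ev]⟩
    · exact ⟨(c, y) :: l', b', h, Nat.succ_le_succ hlen, ⟨hl.1, hl.2.1, hl.2.2.1, hred⟩, by
        rw [ev_cons_mul, heq, ev]; simp only [mul_assoc]⟩

theorem Joins.act_of_ne {g : D.Hat} {x b : X} {l : List (X × X)} {h : H}
    (hg : D.Joins g x l b h) (p : D.Path) (hp : p.1.1 ≠ h⁻¹ • b) :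
    (D.act g p).1 = (x, l ++ (b, h • p.1.1) :: p.1.2) := by
  have hp' : h • p.1.1 ≠ b := fun hb => hp (by rw [← hb, inv_smul_smul])
  have h1 : (D.act (Monoid.Coprod.inl h) p).1.1 ≠ b := by rwa [act_inl]
  rw [hg.2, map_mul, Equiv.Perm.mul_apply, hg.1.act_of_ne _ h1, act_inl]

variable [IsCancelSMul H X]

theorem code_emb (x : X) : (D.code (D.emb x)).1 = (x, []) := by
  have h : D.emb x = Monoid.Coprod.inl (D.coef x) * D.emb (D.rep x) := by
    rw [D.emb_of_mem (D.rep_spec x).1, emb]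
  have h2 : (D.code (D.emb (D.rep x))).1 = (D.rep x, []) := by
    have h3 : D.prolong D.baseRep D.basePath = ⟨[], trivial⟩ :=
      Subtype.ext (D.prolong_val_of_eq D.baseRep D.basePath rfl)
    rw [D.emb_of_mem (D.rep_spec x).1, code, D.act_gen ⟨D.rep x, (D.rep_spec x).1⟩, h3]
    rfl
  rw [h, code_mul, act_inl, h2, D.coef_smul_rep]

theorem gate_emb (x : X) : D.gate (D.emb x) = x := by
  rw [gate, code_emb]

theorem Joins.gate_mul_emb {g : D.Hat} {x b : X} {l : List (X × X)} {h : H}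
    (hg : D.Joins g x l b h) (y : X) : D.gate (g * D.emb y) = x := by
  rw [gate, code_mul]
  by_cases hy : y = h⁻¹ • b
  · rw [hg.2, map_mul, Equiv.Perm.mul_apply, hg.1.act_nil]
    rw [act_inl, code_emb, hy, smul_inv_smul]
  · rw [hg.act_of_ne _ (by rwa [code_emb])]

theorem Joins.gate_eq {g : D.Hat} {x b : X} {l : List (X × X)} {h : H}
    (hg : D.Joins g x l b h) : D.gate g = x := by
  have h1 := hg.gate_mul_emb D.base
  rwa [emb_base, mul_one] at h1

theorem exists_joins {g : D.Hat} (hg : g ∉ (Monoid.Coprod.inl : H →* D.Hat).range) :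
    ∃ x l b h, D.Joins g x l b h := by
  have key := exists_joins_of_reduced D.base_mem (D.code g).2
  rw [gen_base, inv_one, mul_one, ev_code] at key
  rcases key with ⟨h, hh⟩ | ⟨l, b, h, -, hj⟩
  · exact absurd ⟨h, hh.symm⟩ hg
  · exact ⟨_, l, b, h, hj⟩

/-- All paths from `X` to points of another translate of `X` leave `X` at the same point. -/
theorem gate_mul_emb {g : D.Hat} (hg : g ∉ (Monoid.Coprod.inl : H →* D.Hat).range) (y : X) :
    D.gate (g * D.emb y) = D.gate g := by
  obtain ⟨x, l, b, h, hj⟩ := exists_joins hg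
  rw [hj.gate_mul_emb, hj.gate_eq]

theorem Joins.notMem_range {g : D.Hat} {x b : X} {l : List (X × X)} {h : H}
    (hg : D.Joins g x l b h) : g ∉ (Monoid.Coprod.inl : H →* D.Hat).range := by
  rintro ⟨k, rfl⟩
  obtain ⟨y, hy⟩ := hg.1.nontrivial
  apply hy
  have h1 := hg.gate_mul_emb (k⁻¹ • y)
  rwa [gate_inl_mul, gate_emb, smul_inv_smul] at h1

theorem Joins.gate_inv {g : D.Hat} {x b : X} {l : List (X × X)} {h : H}
    (hg : D.Joins g x l b h) : D.gate g⁻¹ = h⁻¹ • b := by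
  obtain ⟨y, hy⟩ := hg.1.nontrivial
  rw [← OrbitReps.gate_mul_emb (fun hmem => hg.notMem_range (inv_mem_iff.1 hmem)) y]
  by_contra hne
  -- Otherwise the path from `X` to `D.emb y` would leave `X` at `x`, while it is the single point
  -- `y ≠ x`.
  have h1 := hg.act_of_ne (D.code (g⁻¹ * D.emb y)) hne
  rw [← code_mul, mul_inv_cancel_left, code_emb] at h1
  exact hy (congrArg Prod.fst h1)

/-- The ping-pong step: seen from `g X`, the vertex set `X` lies behind the point `gate g⁻¹`; a path
leaving through any other point prolongs the path from `X` to `g X`. -/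
theorem gate_mul_of_ne {g : D.Hat} (hg : g ∉ (Monoid.Coprod.inl : H →* D.Hat).range)
    {k : D.Hat} (hk : D.gate k ≠ D.gate g⁻¹) :
    D.gate (g * k) = D.gate g ∧ D.len k < D.len (g * k) := by
  obtain ⟨x, l, b, h, hj⟩ := exists_joins hg
  rw [hj.gate_inv] at hk
  have h1 := hj.act_of_ne (D.code k) hk
  rw [hj.gate_eq, gate, len, len, code_mul, h1]
  refine ⟨rfl, ?_⟩
  simp only [List.length_append, List.length_cons]
  omega

/-- Every element of `Ĥ` is conjugate to an elliptic element, in `H`, or to a hyperbolic one whose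
axis passes through `X`. -/
theorem exists_conj (g : D.Hat) : ∃ k : D.Hat,
    k⁻¹ * g * k ∈ (Monoid.Coprod.inl : H →* D.Hat).range ∨
    (k⁻¹ * g * k ∉ (Monoid.Coprod.inl : H →* D.Hat).range ∧
      D.gate (k⁻¹ * g * k) ≠ D.gate (k⁻¹ * g * k)⁻¹) := by
  have key : ∀ (n : ℕ) (g : D.Hat) (x : X) (l : List (X × X)) (b : X) (h : H), l.length = n →
      D.Joins g x l b h → ∃ k : D.Hat,
        k⁻¹ * g * k ∈ (Monoid.Coprod.inl : H →* D.Hat).range ∨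
        (k⁻¹ * g * k ∉ (Monoid.Coprod.inl : H →* D.Hat).range ∧
          D.gate (k⁻¹ * g * k) ≠ D.gate (k⁻¹ * g * k)⁻¹) := by
    intro n
    induction n using Nat.strong_induction_on with
    | _ n ih =>
      intro g x l b h hn hj
      by_cases hx : x = h⁻¹ • b
      swap
      · refine ⟨1, Or.inr ?_⟩
        rw [inv_one, one_mul, mul_one]
        exact ⟨hj.notMem_range, by rwa [hj.gate_eq, hj.gate_inv]⟩
      have hb := hj.1.mem_reps
      cases l with
      | nil =>
        -- With an empty list, `x = h⁻¹ • b` would have representative `b`, which reducedness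
        -- forbids.
        refine absurd ?_ hj.1.2
        rw [hx, rep_smul, D.rep_of_mem hb]
      | cons a l =>
        obtain ⟨c, y⟩ := a
        -- The paths to `g X` and to `g⁻¹ X` leave `X` at the same point `x`; conjugating by the
        -- first step of the former shortens it.
        have hconj : (D.emb x * (D.gen c)⁻¹)⁻¹ * g * (D.emb x * (D.gen c)⁻¹) =
            D.ev y l * (D.gen c)⁻¹ := by
          rw [hj.2, ev_cons_mul, hx, D.emb_smul_of_mem _ hb, map_inv]
          group
        rcases exists_joins_of_reduced hj.1.1 hj.1.2.2.2.reduced with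
          ⟨h', hh'⟩ | ⟨l', b', h', hlen, hj'⟩
        · exact ⟨_, Or.inl ⟨h', (hconj.trans hh').symm⟩⟩
        · rw [← hconj] at hj'
          obtain ⟨k, hk⟩ := ih l'.length (by rw [← hn]; exact Nat.lt_succ_of_le hlen) _ _ _ _ _
            rfl hj'
          refine ⟨D.emb x * (D.gen c)⁻¹ * k, ?_⟩
          simpa only [mul_inv_rev, mul_assoc] using hk
  by_cases hg : g ∈ (Monoid.Coprod.inl : H →* D.Hat).range
  · exact ⟨1, Or.inl (by rwa [inv_one, one_mul, mul_one])⟩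
  · obtain ⟨x, l, b, h, hj⟩ := exists_joins hg
    exact key _ g x l b h rfl hj

-- Once the projection of `g⁻¹ ^ n * v` differs from `gate g`, the next one is `gate g⁻¹ ∈ Q`, and
-- it stays there. Until then each application of `g⁻¹` either projects to `gate g⁻¹` or shortens
-- the path, so the induction is on `D.len v`.
variable (D) in
theorem eventually_gate_mem {g : D.Hat} (hg : g ∉ (Monoid.Coprod.inl : H →* D.Hat).range)
    {Q : Set X} (h1 : D.gate g⁻¹ ∈ Q) (h2 : D.gate g ∉ Q) (v : D.Hat) :
    ∃ N, ∀ n ≥ N, D.gate (g⁻¹ ^ n * v) ∈ Q := by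
  have hg' : g⁻¹ ∉ (Monoid.Coprod.inl : H →* D.Hat).range := fun h => hg (inv_mem_iff.1 h)
  have hne : ∀ k, D.gate k ∈ Q → D.gate k ≠ D.gate g := fun k hk h => h2 (h ▸ hk)
  have step : ∀ k, D.gate k ≠ D.gate g → D.gate (g⁻¹ * k) = D.gate g⁻¹ := fun k hk =>
    (gate_mul_of_ne hg' (by rwa [inv_inv])).1
  have stay : ∀ k, D.gate k ≠ D.gate g → ∀ n ≥ 1, D.gate (g⁻¹ ^ n * k) ∈ Q := by
    intro k hk n hn
    induction n, hn using Nat.le_induction with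
    | base => rwa [pow_one, step k hk]
    | succ n _ ih => rwa [pow_succ', mul_assoc, step _ (hne _ ih)]
  have shift : ∀ k, (∃ N, ∀ n ≥ N, D.gate (g⁻¹ ^ n * (g⁻¹ * k)) ∈ Q) →
      ∃ N, ∀ n ≥ N, D.gate (g⁻¹ ^ n * k) ∈ Q := by
    rintro k ⟨N, hN⟩
    refine ⟨N + 1, fun n hn => ?_⟩
    obtain ⟨m, rfl⟩ := Nat.exists_eq_add_of_le' (Nat.le_of_add_left_le hn : 1 ≤ n)
    have := hN m (by omega)
    rwa [← mul_assoc, ← pow_succ] at this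
  induction hn : D.len v using Nat.strong_induction_on generalizing v with
  | _ n ih =>
    by_cases hv : D.gate v = D.gate g
    swap
    · exact ⟨1, stay v hv⟩
    refine shift v ?_
    by_cases hu : D.gate (g⁻¹ * v) = D.gate g⁻¹
    · exact ⟨1, stay _ (hne _ (hu ▸ h1))⟩
    · have hlen := (gate_mul_of_ne hg hu).2
      rw [mul_inv_cancel_left, hn] at hlen
      exact ih _ hlen _ rfl

end OrbitReps

/-! ### Universal property and freeness of the action on `X̂` -/

namespace OrbitReps

open MedianSet

variable {H : Type u} {X : Type v} [Group H] [MedianSet X] [MulAction H X] [IsCancelSMul H X]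
  (D : OrbitReps H X)

/-- The embedding of `(H, X)` into `(Ĥ, X̂)`. -/
noncomputable def embHom : ActHom H X D.Hat D.Closure where
  groupHom := Monoid.Coprod.inl
  map x := D.basicPoint (D.emb x)
  map_med := D.basicPoint_emb_med
  map_smul h x := by rw [emb_smul, smul_basicPoint]

theorem imageInOneOrbit_embHom : D.embHom.ImageInOneOrbit :=
  ⟨D.base, fun _ => D.basicPoint_mem_orbit _ _⟩

section UniversalProperty

variable {K : Type w₁} {Y : Type w₂} [Group K] [MedianSet Y] [MulAction K Y]

/-- The images of `b₁` and of a representative `b` determine the image of `D.gen b`, since the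
target action is free. -/
theorem actHom_ext [IsCancelSMul K Y] {Ψ Ψ' : ActHom D.Hat D.Closure K Y}
    (h : Ψ.comp D.embHom = Ψ'.comp D.embHom) : Ψ = Ψ' := by
  have hmap : ∀ x, Ψ.map (D.basicPoint (D.emb x)) = Ψ'.map (D.basicPoint (D.emb x)) :=
    fun x => congrFun (congrArg ActHom.map h) x
  have hbase := hmap D.base
  rw [emb_base] at hbase
  have hgroup : ∀ g, Ψ.groupHom g = Ψ'.groupHom g := by
    intro g
    induction g using D.hat_induction with
    | hH k => exact DFunLike.congr_fun (congrArg ActHom.groupHom h) k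
    | hg b hb =>
      have h1 := hmap b
      rw [D.emb_of_mem hb, map_basicPoint, D.map_basicPoint Ψ', hbase] at h1
      exact IsCancelSMul.right_cancel _ _ _ h1
    | hinv g hg => rw [map_inv, map_inv, hg]
    | hmul g k hg hk => rw [map_mul, map_mul, hg, hk]
  refine ActHom.ext (MonoidHom.ext hgroup) (funext fun M => ?_)
  induction M using D.closure_induction with
  | hb g => rw [map_basicPoint, D.map_basicPoint Ψ', hbase, hgroup]
  | hm A B C hA hB hC => rw [Ψ.map_med, Ψ'.map_med, hA, hB, hC]

/-- Freeness of the target plays no role in existence: any `κ b` carrying the image of `b₁` to that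
of `b` may serve as the image of the generator `b`. -/
theorem exists_factor [IsMedianAction K Y] {ψ : ActHom H X K Y} (hψ : ψ.ImageInOneOrbit) :
    ∃ Ψ : ActHom D.Hat D.Closure K Y, Ψ.comp D.embHom = ψ := by
  have horb : ∀ b, ∃ k : K, k • ψ.map D.base = ψ.map b := by
    obtain ⟨x, hx⟩ := hψ
    intro b
    have h : ψ.map b ∈ MulAction.orbit K (ψ.map D.base) := by
      rw [MulAction.orbit_eq_iff.2 (hx D.base)]
      exact hx b
    exact h
  choose κ hκ using horb
  let φ : D.Hat →* K := Monoid.Coprod.lift ψ.groupHom (FreeGroup.lift fun b => κ b)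
  have hinl : ∀ h, φ (Monoid.Coprod.inl h) = ψ.groupHom h := fun h =>
    Monoid.Coprod.lift_apply_inl _ _ h
  have hgen : ∀ b ∈ D.reps, φ (D.gen b) • ψ.map D.base = ψ.map b := by
    intro b hb
    by_cases hbase : b = D.base
    · rw [hbase, gen_base, map_one, one_smul]
    · rw [D.gen_freeBase ⟨b, hb, hbase⟩, ← hκ b]
      refine congrArg (· • ψ.map D.base) ?_
      exact (Monoid.Coprod.lift_apply_inr _ _ _).trans FreeGroup.lift_apply_of
  have hemb : ∀ x, φ (D.emb x) • ψ.map D.base = ψ.map x := by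
    intro x
    rw [emb, map_mul, mul_smul, hgen _ (D.rep_spec x).1, hinl, ← ψ.map_smul, D.coef_smul_rep]
  have hmed : ∀ (g : D.Hat) (x y z : X), φ (g * D.emb (med x y z)) • ψ.map D.base =
      med (φ (g * D.emb x) • ψ.map D.base) (φ (g * D.emb y) • ψ.map D.base)
        (φ (g * D.emb z) • ψ.map D.base) := by
    intro g x y z
    simp only [map_mul, mul_smul, hemb, ψ.map_med, IsMedianAction.smul_med]
  refine ⟨⟨φ, D.extend (fun g => φ g • ψ.map D.base) hmed, D.extend_med _ hmed, ?_⟩, ?_⟩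
  · intro g M
    induction M using D.closure_induction with
    | hb k => rw [smul_basicPoint, extend_basicPoint, extend_basicPoint, map_mul, mul_smul]
    | hm A B C hA hB hC =>
      rw [IsMedianAction.smul_med, extend_med, extend_med, hA, hB, hC, IsMedianAction.smul_med]
  · refine ActHom.ext (MonoidHom.ext hinl) (funext fun x => ?_)
    exact (D.extend_basicPoint _ hmed _).trans (hemb x)

end UniversalProperty

theorem rtup_embHom : ActHom.RTUP.{u, v, max u v, max u v, w₁, w₂} D.embHom := by
  intro K Y _ _ _ _ _ ψ hψ
  obtain ⟨Ψ, hΨ⟩ := D.exists_factor hψ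
  exact ⟨Ψ, hΨ, fun Ψ' h => D.actHom_ext (h.trans hΨ.symm)⟩

variable [IsMedianAction H X]

theorem gate_mul_emb_med (g : D.Hat) (x y z : X) :
    D.gate (g * D.emb (med x y z)) =
      med (D.gate (g * D.emb x)) (D.gate (g * D.emb y)) (D.gate (g * D.emb z)) := by
  by_cases hg : g ∈ (Monoid.Coprod.inl : H →* D.Hat).range
  · obtain ⟨h, rfl⟩ := hg
    simp only [gate_inl_mul, gate_emb, IsMedianAction.smul_med]
  · simp only [gate_mul_emb hg, med_absorb]

/-- The retraction of `X̂` onto `X`. -/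
noncomputable def retract : D.Closure → X := D.extend D.gate D.gate_mul_emb_med

theorem retract_med (A B C : D.Closure) :
    D.retract (med A B C) = med (D.retract A) (D.retract B) (D.retract C) :=
  D.extend_med D.gate D.gate_mul_emb_med A B C

theorem retract_inl_smul (h : H) (M : D.Closure) :
    D.retract ((Monoid.Coprod.inl h : D.Hat) • M) = h • D.retract M := by
  induction M using D.closure_induction with
  | hb g => rw [smul_basicPoint, retract, extend_basicPoint, extend_basicPoint, gate_inl_mul]
  | hm A B C hA hB hC =>
    rw [IsMedianAction.smul_med, retract_med, retract_med, hA, hB, hC, IsMedianAction.smul_med]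

/-- The preimage in `𝔖` of a prime convex subset of `X` under the projection to `X`. -/
noncomputable def gatePreimage {Q : Set X} (hQ : IsPrimeConvex Q) : D.primeFamily :=
  D.pullback D.gate D.gate_mul_emb_med ⟨Q, hQ⟩

/-- For one set `𝔘(v)` this is `eventually_gate_mem`. It passes to finite unions and intersections.
-/
theorem eventually_smul_notMem {g : D.Hat} (hg : g ∉ (Monoid.Coprod.inl : H →* D.Hat).range)
    {Q : Set X} (hQ : IsPrimeConvex Q) (h1 : D.gate g⁻¹ ∈ Q) (h2 : D.gate g ∉ Q)
    {M : Set D.primeFamily} (hM : M ∈ D.lattice) :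
    ∃ N, ∀ n ≥ N, g ^ n • D.gatePreimage hQ ∉ M := by
  refine latticeClosure_sup_inf_induction (s := Set.range D.basic)
    (p := fun M _ => ∃ N, ∀ n ≥ N, g ^ n • D.gatePreimage hQ ∉ M) ?_ ?_ ?_ hM
  · rintro _ ⟨v, rfl⟩
    obtain ⟨N, hN⟩ := D.eventually_gate_mem hg h1 h2 v
    refine ⟨N, fun n hn h => h ?_⟩
    change D.gate ((g ^ n)⁻¹ * v) ∈ Q
    rw [← inv_pow]
    exact hN n hn
  · rintro A _ B _ ⟨N, hN⟩ ⟨N', hN'⟩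
    exact ⟨max N N', fun n hn h => h.elim (hN n (le_of_max_le_left hn))
      (hN' n (le_of_max_le_right hn))⟩
  · rintro A _ B _ ⟨N, hN⟩ -
    exact ⟨N, fun n hn h => hN n hn h.1⟩

theorem gatePreimage_notMem {g : D.Hat} (hg : g ∉ (Monoid.Coprod.inl : H →* D.Hat).range)
    {Q : Set X} (hQ : IsPrimeConvex Q) (h1 : D.gate g⁻¹ ∈ Q) (h2 : D.gate g ∉ Q)
    {M : D.Closure} (hM : g • M = M) : D.gatePreimage hQ ∉ M.1 := by
  obtain ⟨N, hN⟩ := D.eventually_smul_notMem hg hQ h1 h2 M.2.1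
  rw [← D.pow_smul_mem_iff hM N]
  exact hN N le_rfl

/-- After conjugation, an element of `H` is handled by the retraction to the free `H`-set `X`, and a
hyperbolic element by self-duality of `M`. -/
theorem eq_one_of_smul_eq {g : D.Hat} {M : D.Closure} (hM : g • M = M) : g = 1 := by
  obtain ⟨k, hk⟩ := D.exists_conj g
  have hM' : (k⁻¹ * g * k) • k⁻¹ • M = k⁻¹ • M := by
    rw [smul_smul, mul_inv_cancel_right, mul_smul, hM]
  suffices h : k⁻¹ * g * k = 1 by
    rw [← mul_left_cancel_iff (a := k⁻¹), ← mul_right_cancel_iff (a := k), h]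
    simp
  generalize k⁻¹ * g * k = g' at hk hM'
  generalize k⁻¹ • M = M' at hM'
  rcases hk with ⟨h, rfl⟩ | ⟨hg, hne⟩
  · have h1 := D.retract_inl_smul h M'
    rw [hM'] at h1
    have h2 : h = 1 := IsCancelSMul.right_cancel h 1 (D.retract M') (by rw [← h1, one_smul])
    rw [h2, map_one]
  · obtain ⟨Q, hQ, h1, h2⟩ := exists_primeConvex_separating hne.symm
    have hg' : g'⁻¹ ∉ (Monoid.Coprod.inl : H →* D.Hat).range := fun h => hg (inv_mem_iff.1 h)
    refine absurd ?_ (D.gatePreimage_notMem hg hQ h1 h2 hM')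
    by_contra hP
    -- Passing to `g'⁻¹` and `Qᶜ` excludes the complement as well, so `P` would belong to the
    -- negation of `M'`, which is `M'`.
    refine D.gatePreimage_notMem (Q := Qᶜ) hg' hQ.compl (by rwa [inv_inv]) (fun h => h h1)
      (M := M') (by rw [inv_smul_eq_iff, hM']) ?_
    rw [← M'.2.2] at hP
    exact not_not.1 hP

instance isCancelSMul_closure : IsCancelSMul D.Hat D.Closure where
  right_cancel' g k M h := by
    have h1 : (k⁻¹ * g) • M = M := by rw [mul_smul, h, inv_smul_smul]
    exact (inv_mul_eq_one.1 (D.eq_one_of_smul_eq h1)).symm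

theorem isEmbedding_embHom : D.embHom.IsEmbedding := by
  refine ⟨Monoid.Coprod.inl_injective, fun x y h => ?_⟩
  have h1 := congrArg D.retract h
  change D.retract (D.basicPoint _) = D.retract (D.basicPoint _) at h1
  rwa [retract, extend_basicPoint, extend_basicPoint, gate_emb, gate_emb] at h1

end OrbitReps

theorem theorem4p1 {H : Type u} {X : Type v} [Group H] [MedianSet X] [MulAction H X]
    [IsMedianAction H X] [IsCancelSMul H X] (D : OrbitReps H X) :
    -- the lattice of subsets of `𝔖` from which `X̂` is built is stable under the negation
    (∀ M ∈ D.lattice, D.neg M ∈ D.lattice) ∧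
    -- `Ĥ` acts freely, by automorphisms of median sets, on `X̂`
    IsMedianAction D.Hat D.Closure ∧
    IsCancelSMul D.Hat D.Closure ∧
    -- `H → Ĥ` and `X → Ĥ → X̂` form an embedding of actions on median sets, with `X` going into
    -- one orbit, and with the universal property
    ∃ j : ActHom H X D.Hat D.Closure,
      j.groupHom = Monoid.Coprod.inl ∧
      (∀ x : X, j.map x = D.emb x • D.basePoint) ∧
      j.IsEmbedding ∧
      j.ImageInOneOrbit ∧
      ActHom.RTUP.{u, v, max u v, max u v, w₁, w₂} j ∧
      -- uniqueness, up to a unique isomorphism, among the free actions extending `(H, X)`, with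
      -- `X` going into one orbit, and with the universal property (for test objects in the
      -- universes of both extensions)
      ∀ (H' : Type w₁) (X' : Type w₂) [Group H'] [MedianSet X'] [MulAction H' X']
        [IsMedianAction H' X'] [IsCancelSMul H' X'] (j' : ActHom H X H' X'),
        j'.IsEmbedding → j'.ImageInOneOrbit →
        ActHom.RTUP.{u, v, w₁, w₂, max u v, max u v} j' →
        ActHom.RTUP.{u, v, w₁, w₂, w₁, w₂} j' →
        ∃! Φ : ActHom D.Hat D.Closure H' X', Φ.IsIso ∧ Φ.comp j = j' := by
  refine ⟨fun M => D.neg_mem_lattice, inferInstance, inferInstance, D.embHom, rfl,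
    fun x => (D.smul_basePoint _).symm, D.isEmbedding_embHom, D.imageInOneOrbit_embHom,
    D.rtup_embHom, ?_⟩
  intro H' X' _ _ _ _ _ j' _ horb hj₁ hj₂
  obtain ⟨Φ, hΦ⟩ := D.exists_factor horb
  obtain ⟨Θ, hΘ, -⟩ := hj₁ D.Hat D.Closure D.embHom D.imageInOneOrbit_embHom
  refine ⟨Φ, ⟨⟨Θ, D.actHom_ext ?_, (hj₂ H' X' j' horb).unique ?_ rfl⟩, hΦ⟩,
    fun Φ' h => D.actHom_ext (h.2.trans hΦ.symm)⟩
  -- Both composites fix the embedding of `(H, X)`, so each is the identity by uniqueness of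
  -- factorizations.
  · change Θ.comp (Φ.comp D.embHom) = D.embHom
    rw [hΦ, hΘ]
  · change Φ.comp (Θ.comp j') = j'
    rw [hΘ, hΦ]
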